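/- Let $d\ge 1$, $q\ge 1$, $\Sigma=[q]=\{1,\dots,q\}$. A $d$-dimensional array of size $(n_1,\dots,n_d)$ over the $q$-symbol alphabet is a family of symbols $a_{\mathbf i}\in\Sigma$ indexed by $\mathbf i\in[n_1]\times\dots\times[n_d]$; it has order $n$ if $n_1=\dots=n_d=n$. An array $A$ contains an array $A'$ if $A'$ is obtained from $A$ by repeatedly (zero or more times) choosing $j\in[d]$ and $\ell\in[n_j]$ (where $(n_1,\dots,n_d)$ is the current size) and deleting all symbols whose $j$-th coordinate is $\ell$, which gives an array whose $j$-th side length is smaller by one. The array $A$ is $k$-universal if it contains every $d$-dimensional array over $\Sigma$ of size $(m_1,\dots,m_d)$ with $m_j\le k$ for all $j$. **Theorem.** Let $d,q\ge 2$ be fixed integers and let $\varepsilon>0$ be real. For each $k$ let $n_k$ be $$(1+\varepsilon)\,\frac{k}{e}\,q^{k^{d-1}/d}$$ rounded up or down to an integer (that is, $n_k$ is a non-negative integer at distance less than $1$ from this number). Then the probability that a uniformly random $d$-dimensional array of order $n_k$ over the $q$-symbol alphabet is $k$-universal tends to $1$ as $k\to\infty$. -/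

import Mathlib

/-- A `d`-dimensional array of size `s = (s 0, …, s (d-1))` over the `q`-symbol alphabet `Fin q`. -/
abbrev DArray (d q : ℕ) (s : Fin d → ℕ) : Type :=
  ((j : Fin d) → Fin (s j)) → Fin q

namespace DArray

/-- The coordinate restriction operation: delete all the symbols of `A` whose `j`-th coordinate
is `l`. In the resulting array the `j`-th coordinates `≥ l` are shifted by one. -/
def restrict {d q : ℕ} {s : Fin d → ℕ} (A : DArray d q s) (j : Fin d) (l : Fin (s j)) :
    DArray d q (Function.update s j (s j - 1)) :=
  fun x => A fun i =>
    ⟨if i = j ∧ (l : ℕ) ≤ (x i : ℕ) then (x i : ℕ) + 1 else (x i : ℕ), by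
      have hx := (x i).isLt
      by_cases h : i = j
      · subst h
        have hl := l.isLt
        simp only [Function.update_self] at hx
        split_ifs <;> omega
      · simpa [h] using hx⟩

/-- `A.Contains B`: the array `B` can be obtained from `A` by iteratively applying (zero or more)
coordinate restriction operations. -/
inductive Contains {d q : ℕ} : {s t : Fin d → ℕ} → DArray d q s → DArray d q t → Prop
  | refl {s : Fin d → ℕ} (A : DArray d q s) : Contains A A
  | step {s t : Fin d → ℕ} (A : DArray d q s) (B : DArray d q t) (j : Fin d) (l : Fin (s j)) :
      Contains (A.restrict j l) B → Contains A B

/-- `A` is `k`-universal: it contains every array (over the same alphabet) all of whose side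
lengths are at most `k`. -/
def IsUniversal {d q : ℕ} {s : Fin d → ℕ} (k : ℕ) (A : DArray d q s) : Prop :=
  ∀ t : Fin d → ℕ, (∀ j, t j ≤ k) → ∀ B : DArray d q t, A.Contains B

end DArray

/-!
Fix a `k`-array `M` and `N` rows in each direction. The expected number of copies of `M` in the
random array, one for each choice `T` of `k` of the `N` rows in every direction, is
`choose N k ^ d / q ^ k ^ d`; by Stirling's formula it is at least `(c ^ k / (e k)) ^ d` with
`c > 1`, so that `exp (-expectation / 2)` beats a union bound over the `q ^ k ^ d` patterns `M`.
Such an exponential bound is Janson's inequality in the proof of Boppana and Spencer, with the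
Lovász local lemma in place of Harris's inequality, as having a copy of `M` on the rows `T` is not
a monotone event. It requires that, given a copy on the rows `S`, the expected number of other
copies overlapping it be small. If `S j` and `T j` share `a j` rows, then the two subarrays share
`∏ j, a j` of `k ^ d` entries, and as `d ≥ 2`, AM-GM gives
`∏ j, a j / k ≤ (∑ j, (a j / k) ^ 2) / d`. Hence the sum over `T`, including `T = S`, is at most a
product over the directions, each factor of which is `1 + o(1)`.
-/

section DependencyGraph

open Finset MeasureTheory

variable {Ω I : Type*} {A : I → Set Ω}

/-- The event that none of the events `A i`, `i ∈ S`, occurs. -/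
def noneOf (A : I → Set Ω) (S : Finset I) : Set Ω :=
  ⋂ i ∈ S, (A i)ᶜ

theorem noneOf_empty : noneOf A ∅ = Set.univ := by
  simp [noneOf]

theorem mem_noneOf {S : Finset I} {ω : Ω} : ω ∈ noneOf A S ↔ ∀ i ∈ S, ω ∉ A i := by
  simp [noneOf]

theorem noneOf_anti {S T : Finset I} (h : S ⊆ T) : noneOf A T ⊆ noneOf A S :=
  Set.biInter_subset_biInter_left h

theorem noneOf_insert [DecidableEq I] (i : I) (S : Finset I) :
    noneOf A (insert i S) = noneOf A S \ A i := by
  rw [noneOf, set_biInter_insert, Set.inter_comm, Set.sdiff_eq, noneOf]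

variable [MeasurableSpace Ω] {μ : Measure Ω} {G : SimpleGraph I}

/-- A graph on the indices of a family of events such that the intersection of any two of the
events is independent of avoiding any set of events adjacent to neither of the two. This is what
Janson's inequality needs of a dependency graph; the case `i = j` covers single events. -/
def IsPairDependencyGraph (G : SimpleGraph I) (A : I → Set Ω) (μ : Measure Ω) : Prop :=
  ∀ (i j : I) (S : Finset I), (∀ l ∈ S, l ≠ i ∧ ¬ G.Adj i l) → (∀ l ∈ S, l ≠ j ∧ ¬ G.Adj j l) →
    μ.real (A i ∩ A j ∩ noneOf A S) = μ.real (A i ∩ A j) * μ.real (noneOf A S)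

theorem measureReal_inter_noneOf_filter_not_le [IsFiniteMeasure μ] (E : Set Ω) (S : Finset I)
    (p : I → Prop) [DecidablePred p] :
    μ.real (E ∩ noneOf A {j ∈ S | ¬ p j}) ≤ μ.real (E ∩ noneOf A S) +
      ∑ j ∈ S with p j, μ.real (E ∩ A j ∩ noneOf A {l ∈ S | ¬ p l}) := by
  have hcover : E ∩ noneOf A {j ∈ S | ¬ p j} ⊆ (E ∩ noneOf A S) ∪
      ⋃ j ∈ S.filter p, E ∩ A j ∩ noneOf A {l ∈ S | ¬ p l} := by
    rintro ω ⟨hE, hω⟩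
    by_cases hS : ω ∈ noneOf A S
    · exact .inl ⟨hE, hS⟩
    · simp only [mem_noneOf, not_forall, not_not] at hS
      obtain ⟨j, hjS, hj⟩ := hS
      have hpj : p j := by
        by_contra hpj
        exact mem_noneOf.1 hω j (mem_filter.2 ⟨hjS, hpj⟩) hj
      exact .inr (Set.mem_biUnion (mem_filter.2 ⟨hjS, hpj⟩) ⟨⟨hE, hj⟩, hω⟩)
  calc _ ≤ _ := measureReal_mono hcover
    _ ≤ _ := measureReal_union_le _ _
    _ ≤ _ := by gcongr; exact measureReal_biUnion_finset_le _ _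

variable [DecidableRel G.Adj]

theorem IsPairDependencyGraph.measureReal_inter_noneOf (hG : IsPairDependencyGraph G A μ)
    {S : Finset I} {i : I} (hi : i ∉ S) :
    μ.real (A i ∩ noneOf A {l ∈ S | ¬ G.Adj i l}) =
      μ.real (A i) * μ.real (noneOf A {l ∈ S | ¬ G.Adj i l}) := by
  have hS : ∀ l ∈ S.filter fun l => ¬ G.Adj i l, l ≠ i ∧ ¬ G.Adj i l := fun l hl =>
    ⟨ne_of_mem_of_not_mem (mem_filter.1 hl).1 hi, (mem_filter.1 hl).2⟩
  simpa only [Set.inter_self] using hG i i _ hS hS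

theorem sum_filter_adj_le_of_subset {S U : Finset I} (hSU : S ⊆ U) {i : I} {f : I → ℝ}
    (hf : ∀ j, 0 ≤ f j) {b : ℝ} (hb : ∑ j ∈ U with G.Adj i j, f j ≤ b) :
    ∑ j ∈ S with G.Adj i j, f j ≤ b :=
  (sum_le_sum_of_subset_of_nonneg (filter_subset_filter _ hSU) fun j _ _ => hf j).trans hb

variable {U : Finset I}

/-- A form of the Lovász local lemma. -/
theorem IsPairDependencyGraph.measureReal_noneOf_filter_not_adj_le
    [IsFiniteMeasure μ] (hG : IsPairDependencyGraph G A μ)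
    (hU : ∀ i ∈ U, ∑ j ∈ U with G.Adj i j, μ.real (A j) ≤ 1 / 4) {S : Finset I} (hS : S ⊆ U)
    {i : I} (hi : i ∈ U) :
    μ.real (noneOf A {l ∈ S | ¬ G.Adj i l}) ≤ 2 * μ.real (noneOf A S) := by
  induction S using Finset.strongInduction generalizing i with
  | H S ih =>
    set S' := S.filter fun l => ¬ G.Adj i l with hS'
    have hterm : ∀ j ∈ S.filter fun j => G.Adj i j,
        μ.real (A j ∩ noneOf A S') ≤ μ.real (A j) * (2 * μ.real (noneOf A S')) := by
      intro j hj
      rw [mem_filter] at hj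
      have hjS' : j ∉ S' := by simp [hS', hj.2]
      have hS'S : S' ⊂ S := filter_ssubset.2 ⟨j, hj.1, by simpa using hj.2⟩
      calc μ.real (A j ∩ noneOf A S')
          ≤ μ.real (A j ∩ noneOf A {l ∈ S' | ¬ G.Adj j l}) :=
            measureReal_mono (Set.inter_subset_inter_right _ (noneOf_anti (filter_subset _ _)))
        _ = μ.real (A j) * μ.real (noneOf A {l ∈ S' | ¬ G.Adj j l}) :=
            hG.measureReal_inter_noneOf hjS'
        _ ≤ _ := by
            gcongr
            exact ih S' hS'S (hS'S.subset.trans hS) (hS hj.1)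
    have hsum : ∑ j ∈ S with G.Adj i j, μ.real (A j) ≤ 1 / 4 :=
      sum_filter_adj_le_of_subset hS (fun _ => measureReal_nonneg) (hU i hi)
    have hdelete : μ.real (noneOf A S') ≤
        μ.real (noneOf A S) + ∑ j ∈ S with G.Adj i j, μ.real (A j ∩ noneOf A S') := by
      simpa only [Set.univ_inter] using
        measureReal_inter_noneOf_filter_not_le (μ := μ) (A := A) Set.univ S (G.Adj i)
    have hhalf : μ.real (noneOf A S') ≤
        μ.real (noneOf A S) + 1 / 4 * (2 * μ.real (noneOf A S')) :=
      calc _ ≤ _ := hdelete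
        _ ≤ μ.real (noneOf A S) +
            (∑ j ∈ S with G.Adj i j, μ.real (A j)) * (2 * μ.real (noneOf A S')) := by
          rw [sum_mul]
          gcongr with j hj
          exact hterm j hj
        _ ≤ _ := by gcongr
    linarith

theorem IsPairDependencyGraph.half_mul_le_measureReal_inter_noneOf
    [IsFiniteMeasure μ] (hG : IsPairDependencyGraph G A μ)
    (hU : ∀ i ∈ U, ∑ j ∈ U with G.Adj i j, μ.real (A j) ≤ 1 / 4)
    (hU' : ∀ i ∈ U, ∑ j ∈ U with G.Adj i j, μ.real (A i ∩ A j) ≤ μ.real (A i) / 4)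
    {S : Finset I} (hS : S ⊆ U) {i : I} (hi : i ∈ U) (hiS : i ∉ S) :
    μ.real (A i) / 2 * μ.real (noneOf A S) ≤ μ.real (A i ∩ noneOf A S) := by
  set S' := S.filter fun l => ¬ G.Adj i l with hS'
  have hS'S : S' ⊆ S := filter_subset _ _
  have hterm : ∀ j ∈ S.filter fun j => G.Adj i j,
      μ.real (A i ∩ A j ∩ noneOf A S') ≤ μ.real (A i ∩ A j) * (2 * μ.real (noneOf A S')) := by
    intro j hj
    rw [mem_filter] at hj
    have hjS' : j ∉ S' := by simp [hS', hj.2]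
    calc μ.real (A i ∩ A j ∩ noneOf A S')
        ≤ μ.real (A i ∩ A j ∩ noneOf A {l ∈ S' | ¬ G.Adj j l}) :=
          measureReal_mono (Set.inter_subset_inter_right _ (noneOf_anti (filter_subset _ _)))
      _ = μ.real (A i ∩ A j) * μ.real (noneOf A {l ∈ S' | ¬ G.Adj j l}) := by
          refine hG i j _ (fun l hl => ?_) fun l hl => ?_ <;> rw [mem_filter] at hl
          · exact ⟨ne_of_mem_of_not_mem (hS'S hl.1) hiS, (mem_filter.1 hl.1).2⟩
          · exact ⟨ne_of_mem_of_not_mem hl.1 hjS', hl.2⟩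
      _ ≤ _ := by
          gcongr
          exact hG.measureReal_noneOf_filter_not_adj_le hU (hS'S.trans hS) (hS hj.1)
  have hsum : ∑ j ∈ S with G.Adj i j, μ.real (A i ∩ A j) ≤ μ.real (A i) / 4 :=
    sum_filter_adj_le_of_subset hS (fun _ => measureReal_nonneg) (hU' i hi)
  have hdelete : μ.real (A i) * μ.real (noneOf A S') ≤
      μ.real (A i ∩ noneOf A S) + μ.real (A i) / 4 * (2 * μ.real (noneOf A S')) :=
    calc _ = _ := (hG.measureReal_inter_noneOf hiS).symm
      _ ≤ _ := measureReal_inter_noneOf_filter_not_le _ _ _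
      _ ≤ μ.real (A i ∩ noneOf A S) +
          (∑ j ∈ S with G.Adj i j, μ.real (A i ∩ A j)) * (2 * μ.real (noneOf A S')) := by
        rw [sum_mul]
        gcongr with j hj
        exact hterm j hj
      _ ≤ _ := by gcongr
  calc μ.real (A i) / 2 * μ.real (noneOf A S) ≤ μ.real (A i) / 2 * μ.real (noneOf A S') :=
        mul_le_mul_of_nonneg_left (measureReal_mono (noneOf_anti hS'S)) (by positivity)
    _ ≤ _ := by linarith

theorem IsPairDependencyGraph.measureReal_noneOf_le_exp [IsProbabilityMeasure μ]
    (hG : IsPairDependencyGraph G A μ) (hA : ∀ i, MeasurableSet (A i))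
    (hU : ∀ i ∈ U, ∑ j ∈ U with G.Adj i j, μ.real (A j) ≤ 1 / 4)
    (hU' : ∀ i ∈ U, ∑ j ∈ U with G.Adj i j, μ.real (A i ∩ A j) ≤ μ.real (A i) / 4) :
    μ.real (noneOf A U) ≤ Real.exp (-(∑ i ∈ U, μ.real (A i)) / 2) := by
  classical
  suffices h : ∀ S ⊆ U, μ.real (noneOf A S) ≤ Real.exp (-(∑ i ∈ S, μ.real (A i)) / 2) from
    h U subset_rfl
  intro S hS
  induction S using Finset.induction_on with
  | empty => simp [noneOf_empty]
  | insert i S hiS ih =>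
    obtain ⟨hi, hSU⟩ := insert_subset_iff.1 hS
    have hsplit := measureReal_inter_add_sdiff (μ := μ) (s := noneOf A S) (hA i)
    have hstep := hG.half_mul_le_measureReal_inter_noneOf hU hU' hSU hi hiS
    calc μ.real (noneOf A (insert i S)) = μ.real (noneOf A S) - μ.real (A i ∩ noneOf A S) := by
          rw [noneOf_insert, ← hsplit, Set.inter_comm]
          ring
      _ ≤ (-(μ.real (A i) / 2) + 1) * μ.real (noneOf A S) := by linarith
      _ ≤ Real.exp (-(μ.real (A i) / 2)) *
          Real.exp (-(∑ i ∈ S, μ.real (A i)) / 2) := by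
        gcongr
        · exact Real.add_one_le_exp _
        · exact ih hSU
      _ = _ := by
        rw [← Real.exp_add, sum_insert hiS]
        congr 1
        ring

end DependencyGraph

section Agreement

open Finset MeasureTheory ProbabilityTheory

variable {ι α I : Type*}

/-- The event that a function agrees with the prescribed pattern `v` on `C`. -/
def agreeOn (C : Finset ι) (v : ι → α) : Set (ι → α) :=
  {f | Set.EqOn f v C}

/-- The graph joining two distinct indices of a family of finite sets when the sets meet. -/
def overlapGraph (C : I → Finset ι) : SimpleGraph I where
  Adj i j := i ≠ j ∧ ¬ Disjoint (C i) (C j)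
  symm := ⟨fun _ _ h => ⟨h.1.symm, fun hd => h.2 hd.symm⟩⟩
  loopless := ⟨fun _ h => h.1 rfl⟩

theorem dependsOn_mem_agreeOn (C : Finset ι) (v : ι → α) : DependsOn (· ∈ agreeOn C v) C :=
  fun _ _ hfg => propext ⟨fun h _ hc => (hfg _ hc).symm.trans (h hc),
    fun h _ hc => (hfg _ hc).trans (h hc)⟩

theorem dependsOn_mem_inter {X : ι → Type*} [DecidableEq ι] {C D : Finset ι}
    {E F : Set (∀ i, X i)} (hE : DependsOn (· ∈ E) C) (hF : DependsOn (· ∈ F) D) :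
    DependsOn (· ∈ E ∩ F) ((C ∪ D : Finset ι) : Set ι) := by
  intro f g hfg
  have hfgE : (f ∈ E) = (g ∈ E) := hE fun c hc => hfg c (mem_union_left D hc)
  have hfgF : (f ∈ F) = (g ∈ F) := hF fun c hc => hfg c (mem_union_right C hc)
  simp only [Set.mem_inter_iff, hfgE, hfgF]

theorem dependsOn_mem_noneOf {X : ι → Type*} [DecidableEq ι] {C : I → Finset ι}
    {A : I → Set (∀ i, X i)} (hA : ∀ i, DependsOn (· ∈ A i) (C i)) (S : Finset I) :
    DependsOn (· ∈ noneOf A S) (S.biUnion C : Set ι) := by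
  intro f g hfg
  have hfgA : ∀ i ∈ S, (f ∈ A i) = (g ∈ A i) := fun i hi =>
    hA i fun c hc => hfg c (mem_biUnion.2 ⟨i, hi, hc⟩)
  simp +contextual only [mem_noneOf, hfgA]

theorem measureReal_pi_inter_of_dependsOn [Fintype ι] {X : ι → Type*} [∀ i, Finite (X i)]
    [∀ i, MeasurableSpace (X i)] [∀ i, MeasurableSingletonClass (X i)]
    (μ : ∀ i, Measure (X i)) [∀ i, IsProbabilityMeasure (μ i)] {C D : Finset ι}
    (hCD : Disjoint C D) {E F : Set (∀ i, X i)} (hE : DependsOn (· ∈ E) C)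
    (hF : DependsOn (· ∈ F) D) :
    (Measure.pi μ).real (E ∩ F) = (Measure.pi μ).real E * (Measure.pi μ).real F := by
  have hindep : iIndepFun (fun i (ω : ∀ i, X i) => ω i) (Measure.pi μ) :=
    iIndepFun_pi fun _ => aemeasurable_id
  obtain ⟨E', hE'⟩ := dependsOn_iff_exists_comp.1 hE
  obtain ⟨F', hF'⟩ := dependsOn_iff_exists_comp.1 hF
  obtain rfl : E = (fun ω (i : C) => ω i) ⁻¹' E' := hE'
  obtain rfl : F = (fun ω (i : D) => ω i) ⁻¹' F' := hF'
  simp only [measureReal_def, ← ENNReal.toReal_mul]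
  rw [(hindep.indepFun_finset C D hCD measurable_pi_apply).measure_inter_preimage_eq_mul E' F'
    (Set.toFinite _).measurableSet (Set.toFinite _).measurableSet]

theorem isPairDependencyGraph_overlapGraph [Fintype ι] {X : ι → Type*}
    [∀ i, Finite (X i)] [∀ i, MeasurableSpace (X i)] [∀ i, MeasurableSingletonClass (X i)]
    (μ : ∀ i, Measure (X i)) [∀ i, IsProbabilityMeasure (μ i)] {C : I → Finset ι}
    {A : I → Set (∀ i, X i)} (hA : ∀ i, DependsOn (· ∈ A i) (C i)) :
    IsPairDependencyGraph (overlapGraph C) A (Measure.pi μ) := by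
  classical
  have hdisjoint {i l : I} (h : l ≠ i ∧ ¬ (overlapGraph C).Adj i l) : Disjoint (C i) (C l) :=
    not_not.1 fun hil => h.2 ⟨h.1.symm, hil⟩
  intro i j S hi hj
  refine measureReal_pi_inter_of_dependsOn μ ?_ (dependsOn_mem_inter (hA i) (hA j))
    (dependsOn_mem_noneOf hA S)
  rw [disjoint_union_left, disjoint_biUnion_right, disjoint_biUnion_right]
  exact ⟨fun l hl => hdisjoint (hi l hl), fun l hl => hdisjoint (hj l hl)⟩

variable [MeasurableSpace α] [MeasurableSingletonClass α]

theorem uniformOn_univ_pi [Fintype ι] [Finite α] : uniformOn (Set.univ : Set (ι → α)) =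
    Measure.pi fun _ => uniformOn (Set.univ : Set α) := by
  rw [← uniformOn_pi, Set.pi_univ]

variable [Finite ι] [Fintype α] [Nonempty α]

theorem uniformOn_real_agreeOn (C : Finset ι) (v : ι → α) :
    (uniformOn Set.univ).real (agreeOn C v) = ((Fintype.card α : ℝ) ^ #C)⁻¹ := by
  have := Fintype.ofFinite ι
  have hpi : agreeOn C v = (C : Set ι).pi fun c => {v c} := rfl
  rw [hpi, uniformOn_univ_pi, measureReal_def, Measure.pi_pi_finset]
  simp [uniformOn_univ]

variable [DecidableEq ι]

theorem uniformOn_real_agreeOn_inter_le (C D : Finset ι) (v w : ι → α) :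
    (uniformOn Set.univ).real (agreeOn C v ∩ agreeOn D w) ≤
      ((Fintype.card α : ℝ) ^ #C)⁻¹ * ((Fintype.card α : ℝ) ^ #(D \ C))⁻¹ := by
  have := Fintype.ofFinite ι
  have hsub : agreeOn D w ⊆ agreeOn (D \ C) w := fun f hf => hf.mono (by simp)
  calc (uniformOn Set.univ).real (agreeOn C v ∩ agreeOn D w)
      ≤ (uniformOn Set.univ).real (agreeOn C v ∩ agreeOn (D \ C) w) :=
        measureReal_mono (Set.inter_subset_inter_right _ hsub)
    _ = (uniformOn Set.univ).real (agreeOn C v) *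
        (uniformOn Set.univ).real (agreeOn (D \ C) w) := by
      rw [uniformOn_univ_pi]
      exact measureReal_pi_inter_of_dependsOn _ disjoint_sdiff (dependsOn_mem_agreeOn C v)
        (dependsOn_mem_agreeOn _ w)
    _ = _ := by rw [uniformOn_real_agreeOn, uniformOn_real_agreeOn]

theorem uniformOn_real_noneOf_agreeOn_le_exp {C : I → Finset ι} (v : I → ι → α) {U : Finset I}
    [DecidableRel (overlapGraph C).Adj]
    (hU : ∀ i ∈ U, ∑ j ∈ U with (overlapGraph C).Adj i j,
      ((Fintype.card α : ℝ) ^ #(C j \ C i))⁻¹ ≤ 1 / 4) :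
    (uniformOn Set.univ).real (noneOf (fun i => agreeOn (C i) (v i)) U) ≤
      Real.exp (-(∑ i ∈ U, ((Fintype.card α : ℝ) ^ #(C i))⁻¹) / 2) := by
  have := Fintype.ofFinite ι
  have hcard : (1 : ℝ) ≤ Fintype.card α := mod_cast Fintype.card_pos
  have hG : IsPairDependencyGraph (overlapGraph C) (fun i => agreeOn (C i) (v i))
      (uniformOn Set.univ) := by
    rw [uniformOn_univ_pi]
    exact isPairDependencyGraph_overlapGraph _ fun i => dependsOn_mem_agreeOn _ _
  have := isProbabilityMeasure_uniformOn (s := (Set.univ : Set (ι → α))) Set.finite_univ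
    Set.univ_nonempty
  have hbound := hG.measureReal_noneOf_le_exp (U := U) (fun _ => (Set.toFinite _).measurableSet)
    (fun i hi => (sum_le_sum fun j _ => ?_).trans (hU i hi)) fun i hi => ?_
  · simpa only [uniformOn_real_agreeOn] using hbound
  · rw [uniformOn_real_agreeOn]
    gcongr
    exact sdiff_subset
  · calc _ ≤ ∑ j ∈ U with (overlapGraph C).Adj i j,
          ((Fintype.card α : ℝ) ^ #(C i))⁻¹ * ((Fintype.card α : ℝ) ^ #(C j \ C i))⁻¹ :=
        sum_le_sum fun j _ => uniformOn_real_agreeOn_inter_le _ _ _ _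
      _ ≤ ((Fintype.card α : ℝ) ^ #(C i))⁻¹ * (1 / 4) := by
        rw [← mul_sum]
        gcongr
        exact hU i hi
      _ = _ := by rw [uniformOn_real_agreeOn, mul_one_div]

end Agreement

namespace DArray

open Finset MeasureTheory ProbabilityTheory

variable {d q k : ℕ} {s t : Fin d → ℕ}

/-- The subarray of `A` on the rows selected in each direction `j` by the order embedding
`f j`. -/
def subarray (A : DArray d q s) (f : ∀ j, Fin (t j) ↪o Fin (s j)) : DArray d q t :=
  A ∘ Pi.map fun j => f j

theorem subarray_surjective [NeZero q] (f : ∀ j, Fin (t j) ↪o Fin (s j)) :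
    Function.Surjective fun A : DArray d q s => A.subarray f :=
  (Function.Injective.piMap fun j => (f j).injective).surjective_comp_right

theorem exists_restrict_subarray_eq (A : DArray d q s) (f : ∀ j, Fin (t j) ↪o Fin (s j))
    {j : Fin d} {l : Fin (s j)} (hl : ∀ x, f j x ≠ l) :
    ∃ g, (A.restrict j l).subarray g = A.subarray f := by
  have hl' : ∀ x, (f j x : ℕ) ≠ l := fun x hx => hl x (Fin.ext hx)
  let g (i : Fin d) (x : Fin (t i)) : Fin (Function.update s j (s j - 1) i) :=
    ⟨if i = j ∧ (l : ℕ) < f i x then f i x - 1 else f i x, by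
      have := (f i x).isLt
      obtain rfl | hij := eq_or_ne i j
      · simp only [Function.update_self, true_and]
        have := hl' x
        split_ifs <;> lia
      · simp [hij]⟩
  have hg : ∀ i, StrictMono (g i) := by
    intro i x y hxy
    have hlt : (f i x : ℕ) < f i y := (f i).strictMono hxy
    obtain rfl | hij := eq_or_ne i j
    · have hx := hl' x
      have hy := hl' y
      simp only [Fin.lt_def, g, true_and]
      split_ifs <;> lia
    · simpa [g, hij] using hlt
  refine ⟨fun i => OrderEmbedding.ofStrictMono (g i) (hg i), ?_⟩
  funext x
  refine congrArg A (funext fun i => Fin.ext ?_)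
  obtain rfl | hij := eq_or_ne i j
  · have := hl' (x i)
    simp only [g, Pi.map_apply, OrderEmbedding.coe_ofStrictMono, true_and]
    split_ifs <;> lia
  · simp [g, hij]

theorem contains_subarray (A : DArray d q s) (f : ∀ j, Fin (t j) ↪o Fin (s j)) :
    A.Contains (A.subarray f) := by
  induction hm : ∑ j, s j using Nat.strong_induction_on generalizing s with
  | _ m ih =>
    have hle : ∀ j, t j ≤ s j := fun j => by
      simpa using Fintype.card_le_of_injective _ (f j).injective
    by_cases hst : ∃ j, t j < s j
    · obtain ⟨j, hj⟩ := hst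
      obtain ⟨l, hl⟩ : ∃ l, ∀ x, f j x ≠ l := by
        by_contra! hsurj
        have hcard := Fintype.card_le_of_surjective (f j) hsurj
        simp only [Fintype.card_fin] at hcard
        lia
      obtain ⟨g, hg⟩ := A.exists_restrict_subarray_eq f hl
      have hlt : ∑ i, Function.update s j (s j - 1) i < m := by
        rw [← hm]
        refine sum_lt_sum (fun i _ => ?_) ⟨j, mem_univ j, ?_⟩
        · exact update_le_self_iff.2 (Nat.sub_le _ _) i
        · rw [Function.update_self]
          lia
      exact .step A _ j l (hg ▸ ih _ hlt (A.restrict j l) g rfl)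
    · push Not at hst
      obtain rfl : s = t := funext fun j => (hst j).antisymm (hle j)
      have hid : ∀ j, ⇑(f j) = id := fun j => (f j).strictMono.eq_id
      have hA : A.subarray f = A := by
        funext x
        simp [subarray, hid]
      rw [hA]
      exact .refl A

theorem isUniversal_of_forall_exists_subarray_eq [NeZero q] {A : DArray d q s}
    (hA : ∀ M : DArray d q fun _ => k, ∃ f, A.subarray f = M) : A.IsUniversal k := by
  intro t ht B
  obtain ⟨M, rfl⟩ := subarray_surjective (fun j => Fin.castLEOrderEmb (ht j)) B
  obtain ⟨f, rfl⟩ := hA M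
  exact A.contains_subarray fun j => (Fin.castLEOrderEmb (ht j)).trans (f j)

theorem subarray_eq_of_mem_agreeOn {A v : DArray d q s} {T : ∀ j, Finset (Fin (s j))}
    (hT : ∀ j, #(T j) = k) (hA : A ∈ agreeOn (Fintype.piFinset T) v) :
    A.subarray (fun j => (T j).orderEmbOfFin (hT j)) =
      v.subarray fun j => (T j).orderEmbOfFin (hT j) :=
  funext fun _ => hA (Fintype.mem_piFinset.2 fun _ => orderEmbOfFin_mem _ _ _)

theorem exists_pattern_forall_agreeOn [NeZero q] (s : Fin d → ℕ) (M : DArray d q fun _ => k) :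
    ∃ v : (∀ j, Finset (Fin (s j))) → DArray d q s, ∀ T, (∀ j, #(T j) = k) →
      ∀ A ∈ agreeOn (Fintype.piFinset T) (v T), ∃ f, subarray A f = M := by
  have hv (T : ∀ j, Finset (Fin (s j))) : ∃ v : DArray d q s, (∀ j, #(T j) = k) →
      ∀ A ∈ agreeOn (Fintype.piFinset T) v, ∃ f, subarray A f = M := by
    by_cases hT : ∀ j, #(T j) = k
    · obtain ⟨v, hv⟩ := subarray_surjective (fun j => (T j).orderEmbOfFin (hT j)) M
      exact ⟨v, fun _ A hA => ⟨_, (subarray_eq_of_mem_agreeOn hT hA).trans hv⟩⟩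
    · exact ⟨fun _ => 0, fun h => absurd h hT⟩
  choose v hv using hv
  exact ⟨v, hv⟩

theorem uniformOn_real_not_isUniversal_le [NeZero q] (W : ∀ j, Finset (Fin (s j))) {b : ℝ}
    (hb : ∀ v : (∀ j, Finset (Fin (s j))) → DArray d q s,
      (uniformOn Set.univ).real (noneOf (fun T => agreeOn (Fintype.piFinset T) (v T))
        (Fintype.piFinset fun j => powersetCard k (W j))) ≤ b) :
    (uniformOn Set.univ).real {A : DArray d q s | ¬ A.IsUniversal k} ≤ (q : ℝ) ^ k ^ d * b := by
  choose v hv using fun M : DArray d q fun _ => k => exists_pattern_forall_agreeOn s M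
  have hcover : {A : DArray d q s | ¬ A.IsUniversal k} ⊆ ⋃ M,
      noneOf (fun T => agreeOn (Fintype.piFinset T) (v M T))
        (Fintype.piFinset fun j => powersetCard k (W j)) := by
    intro A hA
    by_contra hcon
    refine hA (isUniversal_of_forall_exists_subarray_eq fun M => ?_)
    simp only [Set.mem_iUnion, mem_noneOf, not_exists, not_forall, not_not] at hcon
    obtain ⟨T, hT, hAT⟩ := hcon M
    exact hv M T (fun j => (mem_powersetCard.1 (Fintype.mem_piFinset.1 hT j)).2) A hAT
  calc _ ≤ _ := measureReal_mono hcover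
    _ ≤ _ := measureReal_iUnion_fintype_le _
    _ ≤ ∑ _M : DArray d q fun _ => k, b := sum_le_sum fun M _ => hb (v M)
    _ = _ := by simp

end DArray

section Overlap

open Finset

theorem prod_le_sum_sq_div_card {ι : Type*} [Fintype ι] (hι : 2 ≤ Fintype.card ι) {x : ι → ℝ}
    (h0 : ∀ j, 0 ≤ x j) (h1 : ∀ j, x j ≤ 1) : ∏ j, x j ≤ (∑ j, x j ^ 2) / Fintype.card ι := by
  have hcard : (0 : ℝ) < Fintype.card ι := by exact_mod_cast two_pos.trans_le hι
  have hpow : ∀ j, x j ≤ (x j ^ 2) ^ (1 / (Fintype.card ι : ℝ)) := by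
    intro j
    rw [← Real.rpow_natCast, ← Real.rpow_mul (h0 j)]
    conv_lhs => rw [← Real.rpow_one (x j)]
    refine Real.rpow_le_rpow_of_exponent_ge' (h0 j) (h1 j) (by positivity) ?_
    rw [mul_one_div, div_le_one hcard]
    exact_mod_cast hι
  calc ∏ j, x j ≤ ∏ j, (x j ^ 2) ^ (1 / (Fintype.card ι : ℝ)) :=
        prod_le_prod (fun j _ => h0 j) fun j _ => hpow j
    _ ≤ ∑ j, 1 / (Fintype.card ι : ℝ) * x j ^ 2 :=
        Real.geom_mean_le_arith_mean_weighted _ _ _ (fun _ _ => by positivity)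
          (by simp [hcard.ne']) fun j _ => sq_nonneg _
    _ = _ := by rw [← mul_sum, one_div_mul_eq_div]

theorem card_filter_card_inter_le {β : Type*} [DecidableEq β] {k a : ℕ} {S W : Finset β}
    (hS : S ∈ powersetCard k W) :
    #{T ∈ powersetCard k W | #(T ∩ S) = a} ≤ k.choose a * (#W - k).choose (k - a) := by
  rw [mem_powersetCard] at hS
  calc #{T ∈ powersetCard k W | #(T ∩ S) = a}
      ≤ #(powersetCard a S ×ˢ powersetCard (k - a) (W \ S)) := by
        refine card_le_card_of_injOn (fun T => (T ∩ S, T \ S)) (fun T hT => ?_)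
          fun T _ T' _ h => ?_
        · simp only [coe_filter, Set.mem_ofPred_eq, mem_powersetCard] at hT
          simp only [coe_product, Set.mem_prod, mem_coe, mem_powersetCard]
          refine ⟨⟨inter_subset_right, hT.2⟩, sdiff_subset_sdiff hT.1.1 subset_rfl, ?_⟩
          have := card_inter_add_card_sdiff T S
          lia
        · simp only [Prod.mk.injEq] at h
          rw [← sdiff_union_inter T S, ← sdiff_union_inter T' S, h.1, h.2]
    _ = _ := by
      rw [card_product, card_powersetCard, card_powersetCard, card_sdiff_of_subset hS.1, hS.2]

theorem card_piFinset_sdiff {ι : Type*} [Fintype ι] [DecidableEq ι] {β : ι → Type*}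
    [∀ j, DecidableEq (β j)] (S T : ∀ j, Finset (β j)) :
    (#(Fintype.piFinset T \ Fintype.piFinset S) : ℝ) =
      ∏ j, (#(T j) : ℝ) - ∏ j, (#(T j ∩ S j) : ℝ) := by
  have h := card_inter_add_card_sdiff (Fintype.piFinset T) (Fintype.piFinset S)
  rw [← Fintype.piFinset_inter, Fintype.card_piFinset, Fintype.card_piFinset] at h
  rw [eq_sub_iff_add_eq']
  exact_mod_cast h

/-- The factor by which two `k`-element sets of rows that share `a` rows are charged in each of
the `d` directions. The exponent comes from bounding the product of the `d` overlap ratios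
`a / k` by the mean of their squares, which splits the correlation of two subarrays into a
product over the directions. -/
noncomputable def overlapWeight (d : ℕ) (q : ℝ) (k a : ℕ) : ℝ :=
  q ^ ((k : ℝ) ^ d / d * (((a : ℝ) / k) ^ 2 - 1))

/-- The total weight of the `k`-element subsets of an `N`-element set that meet a given one, the
summand for `a` accounting for the subsets with overlap `a`. -/
noncomputable def overlapSum (d : ℕ) (q : ℝ) (k N : ℕ) : ℝ :=
  ∑ a ∈ Ioc 0 k, (k.choose a * (N - k).choose (k - a) : ℕ) * overlapWeight d q k a

variable {d k N : ℕ} {q : ℝ}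

theorem overlapWeight_nonneg (hq : 0 ≤ q) (a : ℕ) : 0 ≤ overlapWeight d q k a :=
  Real.rpow_nonneg hq _

theorem overlapSum_nonneg (hq : 0 ≤ q) : 0 ≤ overlapSum d q k N :=
  sum_nonneg fun _ _ => mul_nonneg (Nat.cast_nonneg _) (overlapWeight_nonneg hq _)

theorem overlapWeight_self (hk : k ≠ 0) : overlapWeight d q k k = 1 := by
  simp [overlapWeight, hk]

theorem sum_overlapWeight_le {β : Type*} [DecidableEq β] (hq : 0 ≤ q) {S W : Finset β}
    (hS : S ∈ powersetCard k W) :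
    ∑ T ∈ powersetCard k W with (T ∩ S).Nonempty, overlapWeight d q k #(T ∩ S) ≤
      overlapSum d q k #W := by
  rw [← sum_fiberwise_of_maps_to (t := Ioc 0 k) (g := fun T => #(T ∩ S))]
  · refine sum_le_sum fun a _ => ?_
    rw [sum_congr rfl fun T hT => by rw [(mem_filter.1 hT).2], sum_const, nsmul_eq_mul]
    refine mul_le_mul_of_nonneg_right (Nat.cast_le.2 ?_) (overlapWeight_nonneg hq a)
    refine (card_le_card ?_).trans (card_filter_card_inter_le hS)
    exact filter_subset_filter _ (filter_subset _ _)
  · intro T hT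
    rw [mem_filter] at hT
    refine mem_Ioc.2 ⟨card_pos.2 hT.2, (card_le_card inter_subset_right).trans_eq ?_⟩
    exact (mem_powersetCard.1 hS).2

variable {β : Fin d → Type*} [∀ j, DecidableEq (β j)] {S W : ∀ j, Finset (β j)}

theorem inv_pow_card_sdiff_le_prod_overlapWeight (hd : 2 ≤ d) (hq : 1 ≤ q) (hk : k ≠ 0)
    (S : ∀ j, Finset (β j)) {T : ∀ j, Finset (β j)} (hT : ∀ j, #(T j) = k) :
    (q ^ #(Fintype.piFinset T \ Fintype.piFinset S))⁻¹ ≤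
      ∏ j, overlapWeight d q k #(T j ∩ S j) := by
  have hq0 : 0 < q := by linarith
  have : (k : ℝ) ≠ 0 := mod_cast hk
  have : (d : ℝ) ≠ 0 := by norm_cast; lia
  have hratio : ∏ j, ((#(T j ∩ S j) : ℝ) / k) ≤ (∑ j, ((#(T j ∩ S j) : ℝ) / k) ^ 2) / d := by
    refine (prod_le_sum_sq_div_card (by simpa using hd) (fun j => by positivity)
      fun j => div_le_one_of_le₀ ?_ (by positivity)).trans_eq (by rw [Fintype.card_fin])
    rw [← hT j]
    exact_mod_cast card_le_card inter_subset_left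
  unfold overlapWeight
  rw [← Real.rpow_sum_of_pos hq0, ← Real.rpow_natCast, ← Real.rpow_neg hq0.le]
  refine Real.rpow_le_rpow_of_exponent_le hq ?_
  calc -(#(Fintype.piFinset T \ Fintype.piFinset S) : ℝ)
      = (k : ℝ) ^ d * (∏ j, ((#(T j ∩ S j) : ℝ) / k) - 1) := by
        rw [card_piFinset_sdiff, prod_div_distrib]
        simp only [hT, prod_const, card_univ, Fintype.card_fin]
        field_simp
        ring
    _ ≤ (k : ℝ) ^ d * ((∑ j, ((#(T j ∩ S j) : ℝ) / k) ^ 2) / d - 1) := by gcongr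
    _ = ∑ j, (k : ℝ) ^ d / d * (((#(T j ∩ S j) : ℝ) / k) ^ 2 - 1) := by
      rw [← mul_sum, sum_sub_distrib, sum_const, card_univ, Fintype.card_fin, nsmul_one]
      field_simp

theorem sum_prod_overlapWeight_le (hq : 0 ≤ q)
    (hW : ∀ j, #(W j) = N) (hS : ∀ j, S j ∈ powersetCard k (W j)) :
    ∑ T ∈ Fintype.piFinset (fun j => (powersetCard k (W j)).filter fun R => (R ∩ S j).Nonempty),
      ∏ j, overlapWeight d q k #(T j ∩ S j) ≤ overlapSum d q k N ^ d := by
  rw [← prod_univ_sum _ fun j R => overlapWeight d q k #(R ∩ S j)]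
  calc _ ≤ ∏ _j : Fin d, overlapSum d q k N :=
        prod_le_prod (fun j _ => sum_nonneg fun _ _ => overlapWeight_nonneg hq _)
          fun j _ => hW j ▸ sum_overlapWeight_le hq (hS j)
    _ = _ := by simp

theorem sum_inv_pow_card_sdiff_le (hd : 2 ≤ d) (hq : 1 ≤ q) (hk : k ≠ 0)
    [DecidableRel (overlapGraph fun T : ∀ j, Finset (β j) => Fintype.piFinset T).Adj]
    (hW : ∀ j, #(W j) = N) (hS : ∀ j, S j ∈ powersetCard k (W j)) :
    ∑ T ∈ Fintype.piFinset (fun j => powersetCard k (W j)) with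
      (overlapGraph fun T : ∀ j, Finset (β j) => Fintype.piFinset T).Adj S T,
      (q ^ #(Fintype.piFinset T \ Fintype.piFinset S))⁻¹ ≤ overlapSum d q k N ^ d - 1 := by
  have hq0 : 0 ≤ q := by linarith
  let P (j : Fin d) : Finset (Finset (β j)) :=
    (powersetCard k (W j)).filter fun R => (R ∩ S j).Nonempty
  have hSk : ∀ j, #(S j) = k := fun j => (mem_powersetCard.1 (hS j)).2
  have hSP : S ∈ Fintype.piFinset P := Fintype.mem_piFinset.2 fun j =>
    mem_filter.2 ⟨hS j, by rwa [inter_self, ← card_ne_zero, hSk j]⟩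
  have hself : ∏ j, overlapWeight d q k #(S j ∩ S j) = 1 :=
    prod_eq_one fun j _ => by rw [inter_self, hSk j, overlapWeight_self hk]
  calc _ ≤ ∑ T ∈ (Fintype.piFinset P).erase S,
        (q ^ #(Fintype.piFinset T \ Fintype.piFinset S))⁻¹ := by
        refine sum_le_sum_of_subset_of_nonneg (fun T hT => ?_) fun _ _ _ => by positivity
        rw [mem_filter, Fintype.mem_piFinset] at hT
        obtain ⟨c, hcS, hcT⟩ := not_disjoint_iff.1 hT.2.2
        exact mem_erase.2 ⟨hT.2.1.symm, Fintype.mem_piFinset.2 fun j => mem_filter.2 ⟨hT.1 j, c j,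
          mem_inter.2 ⟨Fintype.mem_piFinset.1 hcT j, Fintype.mem_piFinset.1 hcS j⟩⟩⟩
    _ ≤ ∑ T ∈ (Fintype.piFinset P).erase S, ∏ j, overlapWeight d q k #(T j ∩ S j) := by
        refine sum_le_sum fun T hT =>
          inv_pow_card_sdiff_le_prod_overlapWeight hd hq hk S fun j => ?_
        have hTj := Fintype.mem_piFinset.1 (mem_of_mem_erase hT) j
        exact (mem_powersetCard.1 (mem_filter.1 hTj).1).2
    _ = ∑ T ∈ Fintype.piFinset P, ∏ j, overlapWeight d q k #(T j ∩ S j) - 1 := by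
        rw [sum_erase_eq_sub hSP, hself]
    _ ≤ _ := sub_le_sub_right (sum_prod_overlapWeight_le hq0 hW hS) 1

end Overlap

open Finset ProbabilityTheory in
theorem DArray.uniformOn_real_not_isUniversal_le_exp {d q k N : ℕ} (hd : 2 ≤ d) [NeZero q]
    (hk : k ≠ 0) {s : Fin d → ℕ} (hs : ∀ j, N ≤ s j) (hN : overlapSum d q k N ^ d ≤ 5 / 4) :
    (uniformOn Set.univ).real {A : DArray d q s | ¬ A.IsUniversal k} ≤
      (q : ℝ) ^ k ^ d * Real.exp (-((N.choose k : ℝ) ^ d / (q : ℝ) ^ k ^ d) / 2) := by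
  classical
  have hq : (1 : ℝ) ≤ q := mod_cast NeZero.one_le
  have hW (j : Fin d) : ∃ W : Finset (Fin (s j)), #W = N := by
    obtain ⟨W, -, hW⟩ := exists_subset_card_eq (s := (univ : Finset (Fin (s j)))) (n := N)
      (by simpa using hs j)
    exact ⟨W, hW⟩
  choose W hW using hW
  refine uniformOn_real_not_isUniversal_le W fun v =>
    (uniformOn_real_noneOf_agreeOn_le_exp v fun S hS => ?_).trans_eq ?_
  · rw [Fintype.card_fin]
    exact (sum_inv_pow_card_sdiff_le hd hq hk hW (Fintype.mem_piFinset.1 hS)).trans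
      (by linarith)
  · have hcard : ∀ T ∈ Fintype.piFinset fun j => powersetCard k (W j),
        ((Fintype.card (Fin q) : ℝ) ^ #(Fintype.piFinset T))⁻¹ = ((q : ℝ) ^ k ^ d)⁻¹ := by
      intro T hT
      have hTk : ∀ j, #(T j) = k := fun j =>
        (mem_powersetCard.1 (Fintype.mem_piFinset.1 hT j)).2
      simp [Fintype.card_piFinset, hTk]
    rw [sum_congr rfl hcard, sum_const, nsmul_eq_mul, Fintype.card_piFinset]
    simp [hW, div_eq_mul_inv]

section Asymptotics

open Filter Topology

/-- The order `(k / e) q ^ (k ^ (d - 1) / d)` at which a random `d`-dimensional array over a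
`q`-symbol alphabet becomes `k`-universal. -/
noncomputable def criticalOrder (d : ℕ) (q : ℝ) (k : ℕ) : ℝ :=
  k / Real.exp 1 * q ^ ((k : ℝ) ^ (d - 1) / d)

variable {d k N a b : ℕ} {q c : ℝ}

theorem criticalOrder_nonneg (hq : 0 ≤ q) : 0 ≤ criticalOrder d q k := by
  unfold criticalOrder
  positivity

theorem half_le_pow_div (hd : 2 ≤ d) (hk : 2 ≤ k) : (k : ℝ) / 2 ≤ (k : ℝ) ^ (d - 1) / d := by
  obtain ⟨e, rfl⟩ := Nat.exists_eq_add_of_le' hd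
  have hpow : ((e + 2 : ℕ) : ℝ) ≤ 2 * (k : ℝ) ^ e := by
    have htwo : e + 1 ≤ 2 ^ e := Nat.lt_two_pow_self
    have hke : 2 ^ e ≤ k ^ e := Nat.pow_le_pow_left hk e
    norm_cast
    lia
  rw [Nat.add_succ_sub_one, div_le_div_iff₀ two_pos (by positivity), pow_succ]
  calc (k : ℝ) * (e + 2 : ℕ) ≤ k * (2 * (k : ℝ) ^ e) := by gcongr
    _ = _ := by ring

theorem half_le_rpow_pow_div (hd : 2 ≤ d) (hq : 2 ≤ q) (hk : 2 ≤ k) :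
    (k : ℝ) / 2 ≤ q ^ ((k : ℝ) ^ (d - 1) / d) := by
  have hk2 : (2 : ℝ) ≤ k := mod_cast hk
  have hκ := half_le_pow_div hd hk
  have hbernoulli := one_add_mul_self_le_rpow_one_add (s := q - 1) (by linarith)
    (p := (k : ℝ) ^ (d - 1) / d) (by linarith)
  rw [add_sub_cancel] at hbernoulli
  nlinarith

theorem eventually_le_mul_criticalOrder (hd : 2 ≤ d) (hq : 2 ≤ q) {η : ℝ} (hη : 0 < η) :
    ∀ᶠ k : ℕ in atTop, (k : ℝ) ≤ η * criticalOrder d q k := by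
  filter_upwards [eventually_ge_atTop 2,
    tendsto_natCast_atTop_atTop.eventually_ge_atTop (2 * Real.exp 1 / η)] with k hk hkη
  rw [div_le_iff₀ hη] at hkη
  calc (k : ℝ) = k / Real.exp 1 * (2 * Real.exp 1) / 2 := by field_simp
    _ ≤ k / Real.exp 1 * (k * η) / 2 := by gcongr
    _ = η * (k / Real.exp 1 * (k / 2)) := by ring
    _ ≤ _ := by
      unfold criticalOrder
      gcongr
      exact half_le_rpow_pow_div hd hq hk

theorem overlapWeight_add (hd : d ≠ 0) (hq : 0 < q) (hk : k = a + b) (hk0 : k ≠ 0) :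
    overlapWeight d q k a =
      ((q ^ ((k : ℝ) ^ (d - 1) / d)) ^ b)⁻¹ * q ^ (-((k : ℝ) ^ (d - 1) / d / k * (a * b))) := by
  have hk0' : (k : ℝ) ≠ 0 := mod_cast hk0
  have hb : (b : ℝ) = k - a := by rw [hk]; push_cast; ring
  obtain ⟨e, rfl⟩ := Nat.exists_eq_succ_of_ne_zero hd
  unfold overlapWeight
  rw [← Real.rpow_natCast _ b, ← Real.rpow_mul hq.le, ← Real.rpow_neg hq.le, ← Real.rpow_add hq,
    hb, Nat.succ_sub_one, pow_succ]
  congr 1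
  field_simp
  ring

theorem overlapWeight_add_le (hd : 2 ≤ d) (hq : 2 ≤ q) (hk : k = a + b) (hk2 : 2 ≤ k) :
    overlapWeight d q k a ≤
      ((q ^ ((k : ℝ) ^ (d - 1) / d)) ^ b)⁻¹ * 2 ^ (-((a : ℝ) * b / 2)) := by
  have hκ : (1 : ℝ) / 2 ≤ (k : ℝ) ^ (d - 1) / d / k := by
    rw [le_div_iff₀ (by positivity), one_div_mul_eq_div]
    exact half_le_pow_div hd hk2
  rw [overlapWeight_add (by lia) (by linarith) hk (by lia)]
  gcongr ?_ * ?_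
  calc q ^ (-((k : ℝ) ^ (d - 1) / d / k * (a * b))) ≤ q ^ (-(1 / 2 * ((a : ℝ) * b))) := by
        gcongr
        linarith
    _ ≤ 2 ^ (-(1 / 2 * ((a : ℝ) * b))) :=
        Real.rpow_le_rpow_of_nonpos two_pos hq (neg_nonpos.2 (by positivity))
    _ = _ := by rw [one_div_mul_eq_div]

theorem choose_mul_overlapWeight_le (hd : 2 ≤ d) (hq : 2 ≤ q) (hk : k = a + b) (hk2 : 2 ≤ k)
    (hN : N ≤ c * criticalOrder d q k) :
    ((N - k).choose b : ℝ) * overlapWeight d q k a ≤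
      c ^ b * ((k / Real.exp 1) ^ b / b.factorial) * 2 ^ (-((a : ℝ) * b / 2)) := by
  have hchoose : ((N - k).choose b : ℝ) ≤ (c * criticalOrder d q k) ^ b / b.factorial := by
    refine (Nat.choose_le_pow_div b (N - k)).trans ?_
    gcongr
    exact (Nat.cast_le.2 (Nat.sub_le N k)).trans hN
  calc _ ≤ (c * criticalOrder d q k) ^ b / b.factorial *
        (((q ^ ((k : ℝ) ^ (d - 1) / d)) ^ b)⁻¹ * 2 ^ (-((a : ℝ) * b / 2))) :=
        mul_le_mul hchoose (overlapWeight_add_le hd hq hk hk2)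
          (overlapWeight_nonneg (by linarith) a) ((Nat.cast_nonneg _).trans hchoose)
    _ = _ := by
      unfold criticalOrder
      rw [mul_pow, mul_pow]
      field_simp

theorem choose_le_pow_min (hk : k = a + b) : (k.choose a : ℝ) ≤ (k : ℝ) ^ min a b := by
  norm_cast
  obtain hab | hab := le_total a b
  · rw [min_eq_left hab]
    exact Nat.choose_le_pow k a
  · rw [min_eq_right hab, Nat.choose_symm_of_eq_add hk]
    exact Nat.choose_le_pow k b

theorem div_exp_pow_div_factorial_le (hk : k = a + b) (hk0 : k ≠ 0) :
    ((k : ℝ) / Real.exp 1) ^ b / b.factorial ≤ (Real.exp 1 * k) ^ min a b := by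
  have hk1 : (1 : ℝ) ≤ k := mod_cast Nat.one_le_iff_ne_zero.2 hk0
  have he : 1 ≤ Real.exp 1 := Real.one_le_exp zero_le_one
  obtain hab | hab := le_total a b
  · have hexp : Real.exp k = Real.exp 1 ^ a * Real.exp 1 ^ b := by
      rw [← pow_add, ← hk, Real.exp_one_pow]
    rw [min_eq_left hab]
    calc ((k : ℝ) / Real.exp 1) ^ b / b.factorial
        = (k : ℝ) ^ b / b.factorial / Real.exp 1 ^ b := by rw [div_pow]; ring
      _ ≤ Real.exp k / Real.exp 1 ^ b := by
        gcongr
        exact Real.pow_div_factorial_le_exp _ (by positivity) b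
      _ = Real.exp 1 ^ a := by rw [hexp]; field_simp
      _ ≤ _ := by
        gcongr
        exact le_mul_of_one_le_right (by positivity) hk1
  · rw [min_eq_right hab]
    calc ((k : ℝ) / Real.exp 1) ^ b / b.factorial ≤ ((k : ℝ) / Real.exp 1) ^ b :=
          div_le_self (by positivity) (mod_cast b.factorial_pos)
      _ ≤ _ := by
        gcongr
        exact (div_le_self (by positivity) he).trans (le_mul_of_one_le_left (by positivity) he)

theorem pow_mul_two_rpow_le (hc : 1 ≤ c) (hc8 : c ^ 8 ≤ 2) (hk : k = a + b) (ha : a ≠ 0)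
    (hb : b ≠ 0) : c ^ b * 2 ^ (-((a : ℝ) * b / 2)) ≤ ((2 : ℝ) ^ (-((k : ℝ) / 8))) ^ min a b := by
  have hk' : (k : ℝ) = a + b := mod_cast hk
  have hm : (1 : ℝ) ≤ (min a b : ℕ) := by
    exact_mod_cast le_min (Nat.one_le_iff_ne_zero.2 ha) (Nat.one_le_iff_ne_zero.2 hb)
  have hab : (k : ℝ) * (min a b : ℕ) ≤ 2 * (a * b) := by
    obtain hab | hab := le_total a b
    all_goals have hab' := (Nat.cast_le (α := ℝ)).2 hab
    · rw [min_eq_left hab, hk']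
      nlinarith [mul_nonneg (Nat.cast_nonneg a) (sub_nonneg.2 hab')]
    · rw [min_eq_right hab, hk']
      nlinarith [mul_nonneg (Nat.cast_nonneg b) (sub_nonneg.2 hab')]
  have hcb : c ^ b ≤ 2 ^ ((k : ℝ) * (min a b : ℕ) / 8) :=
    calc c ^ b = (c ^ 8) ^ ((b : ℝ) / 8) := by
          rw [← Real.rpow_natCast c 8, ← Real.rpow_mul (by linarith), ← Real.rpow_natCast]
          congr 1
          push_cast
          ring
      _ ≤ 2 ^ ((b : ℝ) / 8) := by gcongr
      _ ≤ _ := Real.rpow_le_rpow_of_exponent_le one_le_two <| by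
        gcongr
        nlinarith [(Nat.cast_nonneg a : (0 : ℝ) ≤ a), (Nat.cast_nonneg b : (0 : ℝ) ≤ b)]
  calc c ^ b * 2 ^ (-((a : ℝ) * b / 2))
      ≤ 2 ^ ((k : ℝ) * (min a b : ℕ) / 8) * 2 ^ (-((k : ℝ) * (min a b : ℕ) / 4)) :=
        mul_le_mul hcb (Real.rpow_le_rpow_of_exponent_le one_le_two (by linarith))
          (by positivity) (by positivity)
    _ = _ := by
      rw [← Real.rpow_add two_pos, ← Real.rpow_natCast _ (min a b), ← Real.rpow_mul two_pos.le]
      congr 1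
      ring

theorem choose_mul_choose_mul_overlapWeight_le (hd : 2 ≤ d) (hq : 2 ≤ q) (hc : 1 ≤ c)
    (hc8 : c ^ 8 ≤ 2) (hN : N ≤ c * criticalOrder d q k) (hk : k = a + b) (ha : a ≠ 0)
    (hb : b ≠ 0) :
    (k.choose a * (N - k).choose b : ℕ) * overlapWeight d q k a ≤
      (Real.exp 1 * (k : ℝ) ^ 2 * 2 ^ (-((k : ℝ) / 8))) ^ min a b := by
  push_cast
  calc (k.choose a : ℝ) * (N - k).choose b * overlapWeight d q k a
      = k.choose a * ((N - k).choose b * overlapWeight d q k a) := mul_assoc _ _ _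
    _ ≤ k.choose a *
        (c ^ b * ((k / Real.exp 1) ^ b / b.factorial) * 2 ^ (-((a : ℝ) * b / 2))) :=
      mul_le_mul_of_nonneg_left (choose_mul_overlapWeight_le hd hq hk (by lia) hN)
        (Nat.cast_nonneg _)
    _ = k.choose a * ((k / Real.exp 1) ^ b / b.factorial) *
        (c ^ b * 2 ^ (-((a : ℝ) * b / 2))) := by ring
    _ ≤ (k : ℝ) ^ min a b * (Real.exp 1 * k) ^ min a b *
        ((2 : ℝ) ^ (-((k : ℝ) / 8))) ^ min a b := by
      gcongr
      · exact choose_le_pow_min hk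
      · exact div_exp_pow_div_factorial_le hk (by lia)
      · exact pow_mul_two_rpow_le hc hc8 hk ha hb
    _ = _ := by rw [← mul_pow, ← mul_pow]; ring_nf

theorem overlapSum_le (hd : 2 ≤ d) (hq : 2 ≤ q) (hc : 1 ≤ c) (hc8 : c ^ 8 ≤ 2)
    (hN : N ≤ c * criticalOrder d q k) (hk : k ≠ 0)
    (hk1 : Real.exp 1 * (k : ℝ) ^ 2 * 2 ^ (-((k : ℝ) / 8)) ≤ 1) :
    overlapSum d q k N ≤ 1 + k * (Real.exp 1 * (k : ℝ) ^ 2 * 2 ^ (-((k : ℝ) / 8))) := by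
  have hterm : ∀ a ∈ Finset.Ioo 0 k,
      (k.choose a * (N - k).choose (k - a) : ℕ) * overlapWeight d q k a ≤
        Real.exp 1 * (k : ℝ) ^ 2 * 2 ^ (-((k : ℝ) / 8)) := by
    intro a ha
    rw [Finset.mem_Ioo] at ha
    refine (choose_mul_choose_mul_overlapWeight_le hd hq hc hc8 hN
      (by lia) (by lia) (by lia)).trans ?_
    exact pow_le_of_le_one (by positivity) hk1 (by lia)
  rw [overlapSum, ← Finset.Ioo_insert_right (Nat.pos_of_ne_zero hk),
    Finset.sum_insert Finset.right_notMem_Ioo, overlapWeight_self hk]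
  gcongr
  · simp
  · refine (Finset.sum_le_card_nsmul _ _ _ hterm).trans ?_
    rw [nsmul_eq_mul, Nat.card_Ioo]
    gcongr
    lia

theorem tendsto_mul_exp_one_mul_sq_mul_two_rpow :
    Tendsto (fun k : ℕ => (k : ℝ) * (Real.exp 1 * (k : ℝ) ^ 2 * 2 ^ (-((k : ℝ) / 8))))
      atTop (𝓝 0) := by
  have hlt : |(2 : ℝ) ^ (-(1 / 8 : ℝ))| < 1 := by
    rw [abs_of_pos (by positivity)]
    exact Real.rpow_lt_one_of_one_lt_of_neg one_lt_two (by norm_num)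
  have hlim := (tendsto_pow_const_mul_const_pow_of_abs_lt_one 3 hlt).const_mul (Real.exp 1)
  rw [mul_zero] at hlim
  refine hlim.congr fun k => ?_
  rw [← Real.rpow_natCast _ k, ← Real.rpow_mul two_pos.le, neg_mul, one_div_mul_eq_div]
  ring

theorem eventually_overlapSum_pow_le (hd : 2 ≤ d) (hq : 2 ≤ q) (hc : 1 ≤ c) (hc8 : c ^ 8 ≤ 2)
    {C : ℝ} (hC : 1 < C) :
    ∀ᶠ k : ℕ in atTop, ∀ N : ℕ, N ≤ c * criticalOrder d q k → overlapSum d q k N ^ d ≤ C := by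
  have hlim := tendsto_mul_exp_one_mul_sq_mul_two_rpow
  have hlim_pow := (hlim.const_add 1).pow d
  rw [add_zero, one_pow] at hlim_pow
  filter_upwards [hlim.eventually_le_const one_pos, hlim_pow.eventually_le_const hC,
    eventually_ge_atTop 1] with k hle hle_pow hk N hN
  have hk1 : (1 : ℝ) ≤ k := mod_cast hk
  refine (pow_le_pow_left₀ (overlapSum_nonneg (by linarith)) ?_ d).trans hle_pow
  exact overlapSum_le hd hq hc hc8 hN (by lia)
    ((le_mul_of_one_le_left (by positivity) hk1).trans hle)

theorem factorial_le_exp_one_mul_mul_pow (hk : k ≠ 0) :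
    (k.factorial : ℝ) ≤ Real.exp 1 * k * (k / Real.exp 1) ^ k := by
  obtain ⟨m, rfl⟩ := Nat.exists_eq_succ_of_ne_zero hk
  have hstirling : Stirling.stirlingSeq (m + 1) ≤ Real.exp 1 / √2 :=
    Stirling.stirlingSeq_one ▸ Stirling.stirlingSeq'_antitone (Nat.zero_le m)
  rw [Stirling.stirlingSeq, div_le_iff₀ (by positivity)] at hstirling
  have hsqrt : √(m + 1 : ℝ) ≤ m + 1 := Real.sqrt_le_iff.2 ⟨by positivity, by nlinarith⟩
  calc _ ≤ _ := hstirling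
    _ = Real.exp 1 * √(m + 1 : ℝ) * ((m + 1 : ℕ) / Real.exp 1) ^ (m + 1) := by
      push_cast
      rw [Real.sqrt_mul zero_le_two]
      field_simp
    _ ≤ _ := by
      push_cast
      gcongr

theorem rpow_pow_div_pow_pow (hd : d ≠ 0) (hq : 0 ≤ q) :
    ((q ^ ((k : ℝ) ^ (d - 1) / d)) ^ k) ^ d = q ^ k ^ d := by
  obtain ⟨e, rfl⟩ := Nat.exists_eq_succ_of_ne_zero hd
  rw [← pow_mul, ← Real.rpow_natCast _ (k * (e + 1)), ← Real.rpow_mul hq,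
    ← Real.rpow_natCast _ (k ^ (e + 1))]
  congr 1
  push_cast
  rw [pow_succ]
  field_simp

theorem pow_div_mul_le_choose (hq : 0 ≤ q) (hk : k ≠ 0) (hc : 0 ≤ c)
    (hN : c * criticalOrder d q k + k ≤ N + 1) :
    c ^ k / (Real.exp 1 * k) * (q ^ ((k : ℝ) ^ (d - 1) / d)) ^ k ≤ N.choose k := by
  have hcrit : c * criticalOrder d q k ≤ (N + 1 - k : ℕ) := by
    have hcast : ((N + 1 : ℕ) : ℝ) ≤ (N + 1 - k : ℕ) + k := by
      norm_cast
      lia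
    push_cast at hcast
    linarith
  have hfac : 1 / (Real.exp 1 * k) ≤ (k / Real.exp 1 : ℝ) ^ k / k.factorial := by
    rw [div_le_div_iff₀ (by positivity) (by positivity), one_mul, mul_comm]
    exact factorial_le_exp_one_mul_mul_pow hk
  calc _ = c ^ k * (q ^ ((k : ℝ) ^ (d - 1) / d)) ^ k * (1 / (Real.exp 1 * k)) := by ring
    _ ≤ c ^ k * (q ^ ((k : ℝ) ^ (d - 1) / d)) ^ k *
        ((k / Real.exp 1) ^ k / k.factorial) := by gcongr
    _ = (c * criticalOrder d q k) ^ k / k.factorial := by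
      rw [criticalOrder, mul_pow, mul_pow]
      ring
    _ ≤ ((N + 1 - k : ℕ) : ℝ) ^ k / k.factorial := by
      have := criticalOrder_nonneg (d := d) (k := k) hq
      gcongr
    _ ≤ _ := Nat.pow_le_choose k N

theorem pow_div_pow_le_choose_pow_div (hd : d ≠ 0) (hq : 0 < q) (hk : k ≠ 0) (hc : 0 ≤ c)
    (hN : c * criticalOrder d q k + k ≤ N + 1) :
    (c ^ k / (Real.exp 1 * k)) ^ d ≤ (N.choose k : ℝ) ^ d / q ^ k ^ d := by
  rw [← rpow_pow_div_pow_pow hd hq.le, le_div_iff₀ (by positivity), ← mul_pow]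
  gcongr
  exact pow_div_mul_le_choose hq.le hk hc hN

theorem tendsto_pow_mul_exp_neg_pow_div (hd : d ≠ 0) (hq : 1 ≤ q) (hc : 1 < c) :
    Tendsto (fun k : ℕ => q ^ k ^ d * Real.exp (-(c ^ k / (Real.exp 1 * k)) ^ d / 2))
      atTop (𝓝 0) := by
  have hlog : 0 ≤ Real.log q := Real.log_nonneg hq
  have hsmall := (tendsto_pow_const_div_const_pow_of_one_lt (d + 1) hc).eventually_le_const
    (show (0 : ℝ) < 1 / (2 * Real.exp 1 * (Real.log q + 1)) by positivity)
  refine tendsto_of_tendsto_of_tendsto_of_le_of_le' tendsto_const_nhds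
    (Real.tendsto_exp_neg_atTop_nhds_zero.comp tendsto_natCast_atTop_atTop)
    (.of_forall fun k => by positivity) ?_
  filter_upwards [hsmall, eventually_ge_atTop 1] with k hk hk1
  have hk1' : (1 : ℝ) ≤ k := mod_cast hk1
  set Y := c ^ k / (Real.exp 1 * k)
  have hkd : (k : ℝ) ≤ (k : ℝ) ^ d := le_self_pow₀ hk1' hd
  have hY : 2 * ((k : ℝ) ^ d * (Real.log q + 1)) ≤ Y := by
    rw [div_le_div_iff₀ (by positivity) (by positivity), pow_succ] at hk
    rw [le_div_iff₀ (by positivity)]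
    linarith
  have hYd : Y ≤ Y ^ d := le_self_pow₀ (by nlinarith) hd
  have hqk : q ^ k ^ d = Real.exp ((k : ℝ) ^ d * Real.log q) := by
    rw [← Nat.cast_pow, Real.exp_nat_mul, Real.exp_log (by linarith)]
  rw [Function.comp_apply, hqk, ← Real.exp_add, Real.exp_le_exp]
  linarith

end Asymptotics

section MainTheorem

open Filter Topology MeasureTheory ProbabilityTheory

theorem tendsto_measure_nhds_one_of_compl {κ : Type*} {l : Filter κ} {Ω : κ → Type*}
    [∀ k, MeasurableSpace (Ω k)] {μ : ∀ k, Measure (Ω k)} [∀ k, IsProbabilityMeasure (μ k)]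
    {S : ∀ k, Set (Ω k)} (hS : ∀ k, MeasurableSet (S k))
    (h : Tendsto (fun k => (μ k).real (S k)ᶜ) l (𝓝 0)) :
    Tendsto (fun k => μ k (S k)) l (𝓝 1) := by
  have hlim := ENNReal.tendsto_ofReal (h.const_sub 1)
  rw [sub_zero, ENNReal.ofReal_one] at hlim
  refine hlim.congr fun k => ?_
  rw [probReal_compl_eq_one_sub (hS k), sub_sub_cancel, ofReal_measureReal]

theorem DArray.eventually_uniformOn_real_not_isUniversal_le {d q : ℕ} (hd : 2 ≤ d) (hq : 2 ≤ q)
    {δ : ℝ} (hδ : 0 < δ) (hδ8 : (1 + δ) ^ 8 ≤ 2) {s : ℕ → Fin d → ℕ}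
    (hs : ∀ᶠ k in atTop, ∀ j, ⌊(1 + δ) * criticalOrder d q k⌋₊ ≤ s k j) :
    ∀ᶠ k in atTop,
      (uniformOn (Set.univ : Set (DArray d q (s k)))).real {A | A.IsUniversal k}ᶜ ≤
        (q : ℝ) ^ k ^ d * Real.exp (-((1 + δ / 2) ^ k / (Real.exp 1 * k)) ^ d / 2) := by
  have : NeZero q := ⟨by lia⟩
  have hq2 : (2 : ℝ) ≤ q := mod_cast hq
  filter_upwards [hs, eventually_ne_atTop 0,
    eventually_overlapSum_pow_le hd hq2 (by linarith) hδ8 (show (1 : ℝ) < 5 / 4 by norm_num),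
    eventually_le_mul_criticalOrder hd hq2 (half_pos hδ)] with k hsk hk hoverlap hcrit
  have hN_le : (⌊(1 + δ) * criticalOrder d q k⌋₊ : ℝ) ≤ (1 + δ) * criticalOrder d q k :=
    Nat.floor_le (mul_nonneg (by linarith) (criticalOrder_nonneg (by linarith)))
  have hN_lt := Nat.lt_floor_add_one ((1 + δ) * criticalOrder d q k)
  have hcopies := pow_div_pow_le_choose_pow_div (d := d) (q := q) (c := 1 + δ / 2)
    (N := ⌊(1 + δ) * criticalOrder d q k⌋₊) (by lia) (by linarith) hk (by linarith) (by linarith)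
  refine (uniformOn_real_not_isUniversal_le_exp hd hk hsk (hoverlap _ hN_le)).trans ?_
  rw [neg_div, neg_div]
  gcongr

theorem theorem3_general (d q : ℕ) (hd : 2 ≤ d) (hq : 2 ≤ q) (ε : ℝ) (hε : 0 < ε)
    (s : ℕ → Fin d → ℕ)
    (hs : ∀ᶠ k in atTop, ∀ j, ⌊(1 + ε) * criticalOrder d q k⌋₊ ≤ s k j) :
    Tendsto
      (fun k => uniformOn (Set.univ : Set (DArray d q (s k))) {A | A.IsUniversal k})
      atTop (𝓝 1) := by
  have : NeZero q := ⟨by lia⟩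
  have (k : ℕ) : IsProbabilityMeasure (uniformOn (Set.univ : Set (DArray d q (s k)))) :=
    isProbabilityMeasure_uniformOn Set.finite_univ Set.univ_nonempty
  have hδ : 0 < min ε (1 / 16) := by positivity
  have hδ8 : (1 + min ε (1 / 16)) ^ 8 ≤ 2 :=
    (pow_le_pow_left₀ (by positivity) (by gcongr; exact min_le_right _ _) 8).trans
      (show (1 + 1 / 16 : ℝ) ^ 8 ≤ 2 by norm_num)
  refine tendsto_measure_nhds_one_of_compl (fun k => Set.toFinite _ |>.measurableSet) <|
    squeeze_zero' (.of_forall fun k => measureReal_nonneg)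
      (DArray.eventually_uniformOn_real_not_isUniversal_le hd hq hδ hδ8 ?_)
      (tendsto_pow_mul_exp_neg_pow_div (by lia) (mod_cast by lia) (by linarith))
  filter_upwards [hs] with k hsk j
  refine (Nat.floor_mono ?_).trans (hsk j)
  have := criticalOrder_nonneg (d := d) (k := k) (Nat.cast_nonneg (α := ℝ) q)
  gcongr
  exact min_le_left _ _

end MainTheorem

/-- The order `(1 + ε) (k / e) q ^ (k ^ (d - 1) / d)` is a real number, so the order `n k` is any
rounding of it to a natural number. -/
theorem theorem3 (d q : ℕ) (hd : 2 ≤ d) (hq : 2 ≤ q) (ε : ℝ) (hε : 0 < ε) (n : ℕ → ℕ)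
    (hn : ∀ k : ℕ, |(n k : ℝ) -
      (1 + ε) * ((k : ℝ) / Real.exp 1) * (q : ℝ) ^ ((k : ℝ) ^ (d - 1) / (d : ℝ))| < 1) :
    Filter.Tendsto
      (fun k : ℕ => ProbabilityTheory.uniformOn (Set.univ : Set (DArray d q fun _ => n k))
        {A | A.IsUniversal k})
      Filter.atTop (nhds 1) := by
  refine theorem3_general d q hd hq ε hε _ (.of_forall fun k _ => Nat.lt_succ_iff.1 ?_)
  rw [Nat.floor_lt' (Nat.succ_ne_zero _), criticalOrder, ← mul_assoc, Nat.cast_succ]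
  linarith [(abs_lt.1 (hn k)).1]
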